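/- Let $1<p<q<\infty$. For integers $m,n\ge 1$ and reals $0<\alpha<m$, $0<\beta<n$, define on $\mathbb R^m\times\mathbb R^n$ (with Lebesgue measure, $|\cdot|$ being the Euclidean norm on each factor) the product kernel $$\Omega(x,y)=\left(\frac1{|x|}\right)^{m-\alpha}\left(\frac1{|y|}\right)^{n-\beta},$$ and for a (real- or complex-valued) function $f$ put $$(f*\Omega)(x,y)=\iint_{\mathbb R^m\times\mathbb R^n} f(u,v)\,\Omega(x-u,y-v)\,du\,dv$$ wherever this integral converges absolutely, and $(f*\Omega)(x,y)=0$ elsewhere. Then there is a finite constant $A_{p,q}$, depending only on $p$ and $q$, such that for all $m,n,\alpha,\beta$ as above the following hold. 1. There is a finite constant $C$ with $$\|f*\Omega\|_{L^q(\mathbb R^m\times\mathbb R^n)}\le C\,\|f\|_{L^p(\mathbb R^m\times\mathbb R^n)}\qquad\text{for all } f\in L^p(\mathbb R^m\times\mathbb R^n)$$ if and only if $$\frac1p-\frac1q=\frac{\alpha}{m}=\frac{\beta}{n}.$$ 2. If $\frac1p-\frac1q=\frac{\alpha}{m}=\frac{\beta}{n}$, then for every $f\in L^p(\mathbb R^m\times\mathbb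 R^n)$ the integral defining $f*\Omega$ converges absolutely almost everywhere, $f*\Omega\in L^q(\mathbb R^m\times\mathbb R^n)$, and $$\|f*\Omega\|_{L^q(\mathbb R^m\times\mathbb R^n)}\le A_{p,q}\,\|f\|_{L^p(\mathbb R^m\times\mathbb R^n)}.$$ -/

import Mathlib

open MeasureTheory
open scoped ENNReal NNReal

noncomputable section

/-- The product space `ℝᵐ × ℝⁿ`, each factor with its Euclidean norm; its `volume` is
Lebesgue measure. -/
abbrev ProductSpace (m n : ℕ) : Type :=
  EuclideanSpace ℝ (Fin m) × EuclideanSpace ℝ (Fin n)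

/-- The product kernel `Ω(x, y) = (1 / |x|) ^ (m - α) * (1 / |y|) ^ (n - β)`
(its value on the null set where `x = 0` or `y = 0` is immaterial). -/
def productKernel (m n : ℕ) (α β : ℝ) (z : ProductSpace m n) : ℝ :=
  (1 / ‖z.1‖) ^ ((m : ℝ) - α) * (1 / ‖z.2‖) ^ ((n : ℝ) - β)

/-- Multiplication of a scalar of `𝕜` by a real number, as a bilinear map `(a, r) ↦ r • a`. -/
def scalarMul (𝕜 : Type*) [RCLike 𝕜] : 𝕜 →L[ℝ] ℝ →L[ℝ] 𝕜 :=
  (ContinuousLinearMap.lsmul ℝ ℝ).flip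

/-- The convolution `(f * Ω)(z) = ∫ f(w) Ω(z - w) dw` over `ℝᵐ × ℝⁿ`. -/
def convKernel {𝕜 : Type*} [RCLike 𝕜] {m n : ℕ} (α β : ℝ) (f : ProductSpace m n → 𝕜) :
    ProductSpace m n → 𝕜 :=
  convolution f (productKernel m n α β) (scalarMul 𝕜) volume

/-- Absolute convergence of the integral that defines `(f * Ω)(z)`. -/
def ConvKernelExistsAt {𝕜 : Type*} [RCLike 𝕜] {m n : ℕ} (α β : ℝ) (f : ProductSpace m n → 𝕜)
    (z : ProductSpace m n) : Prop :=
  ConvolutionExistsAt f (productKernel m n α β) z (scalarMul 𝕜) volume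

/-- The inequality `‖f * Ω‖_q ≤ A ‖f‖_p` for all `f ∈ L^p(ℝᵐ × ℝⁿ)`. -/
def ProductHLSBound (𝕜 : Type*) [RCLike 𝕜] (m n : ℕ) (α β p q : ℝ) (A : ℝ≥0) : Prop :=
  ∀ f : ProductSpace m n → 𝕜, MemLp f (ENNReal.ofReal p) volume →
    eLpNorm (convKernel α β f) (ENNReal.ofReal q) volume
      ≤ A * eLpNorm f (ENNReal.ofReal p) volume

/-- The exponent relation `1 / p - 1 / q = α / m = β / n`. -/
def ExponentRelation (m n : ℕ) (α β p q : ℝ) : Prop :=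
  1 / p - 1 / q = α / (m : ℝ) ∧ α / (m : ℝ) = β / (n : ℝ)

end

/-!
The proof rests on a short proof of the Hardy–Littlewood–Sobolev inequality whose constant does not
see the dimension, and which tensorizes.

Sufficiency. On one factor `E = ℝᵐ`, distances are measured by the volume `ρ(x)` of the ball through
`x` (`ballVolume`); the law of `ρ` is Lebesgue measure on the half-line in every positive dimension
(`map_ballVolume`), and the Riesz kernel is `V ^ (1 - α / m) ρ ^ (α / m - 1)`, where `V` is the volume
of the unit ball, which is bounded in `m` (`exists_unitBall_volume_le`). Let `s` be the conjugate
exponent of `q`, so that `1 / p + 1 / s = 1 + α / m`. After normalization, `A = f ^ p` and `B = h ^ s`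
have integral `1`. The pointwise inequality
`A ^ (1/p) B ^ (1/s) ρ ^ (1/p + 1/s - 2) ≤ A B + ρ ^ (-2) τ(A ρ) + ρ ^ (-2) τ(B ρ)` with
`τ(t) = min (t ^ (1 + ε), t ^ (1 - ε))` (`rpow_mul_rpow_mul_rpow_le`) is then integrated: the
last two terms have integrals at most `2 / ε`, since `∫ r ^ (-2) τ(A r) dr ≤ (2 / ε) A` over the
half-line. This bounds the bilinear form `∬ f(u) h(x) ρ(x - u) ^ (α / m - 1)`
(`bilinearBound_ballVolume`).

Bilinear bounds pass to products by Tonelli's theorem (`BilinearBound.prod`), and by the converse of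
Hölder's inequality a bilinear bound is an `L^p → L^q` bound for the convolution of nonnegative
functions (`BilinearBound.operator`). Applied to `|f|`, this gives absolute convergence almost
everywhere and the norm inequality (`convKernel_bounds`).

Necessity. For the indicator of `B(0, δ) × B(0, η)` the convolution is at least a constant times
`δ ^ α η ^ β` on the same set (`le_norm_convKernel_indicator`), so that a norm inequality bounds
`δ ^ (α + m (1/q - 1/p)) η ^ (β + n (1/q - 1/p))` for all `δ, η > 0`, and both exponents vanish.
-/

/-! ### A pointwise inequality replacing interpolation -/

/-- `min (t ^ (1 + ε), t ^ (1 - ε))`: a perturbation of the identity which, once rescaled, is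
integrable against `dr / r ^ 2` both at `0` and at `∞`. -/
noncomputable def truncPow (ε : ℝ) (t : ℝ≥0∞) : ℝ≥0∞ := min (t ^ (1 + ε)) (t ^ (1 - ε))

lemma measurable_truncPow (ε : ℝ) : Measurable (truncPow ε) := by
  unfold truncPow
  fun_prop

lemma rpow_le_truncPow {ε c : ℝ} (hε : 0 ≤ ε) (hc : c ≤ 1 - ε) {t : ℝ≥0∞} (ht : 1 ≤ t) :
    t ^ c ≤ truncPow ε t :=
  le_min (ENNReal.rpow_le_rpow_of_exponent_le ht (by linarith))
    (ENNReal.rpow_le_rpow_of_exponent_le ht hc)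

lemma rpow_le_truncPow' {ε c : ℝ} (hε : 0 ≤ ε) (hc : 1 + ε ≤ c) {t : ℝ≥0∞} (ht : t ≤ 1) :
    t ^ c ≤ truncPow ε t :=
  le_min (ENNReal.rpow_le_rpow_of_exponent_ge ht hc)
    (ENNReal.rpow_le_rpow_of_exponent_ge ht (by linarith))

/-- The inequality at unit distance: either both variables are large and the product wins, or
the larger one controls the left-hand side on its own. -/
lemma rpow_mul_rpow_le_mul_add_truncPow {a b ε : ℝ} (ha : 0 < a) (hb : 0 < b) (hε : 0 ≤ ε)
    (hab : 1 + ε ≤ a + b) (haε : a ≤ 1 - ε) (hbε : b ≤ 1 - ε) (A B : ℝ≥0∞) :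
    A ^ a * B ^ b ≤ A * B + truncPow ε A + truncPow ε B := by
  rcases le_total 1 A with hA | hA <;> rcases le_total 1 B with hB | hB
  · calc A ^ a * B ^ b ≤ A ^ (1 : ℝ) * B ^ (1 : ℝ) := by
          gcongr <;> first | assumption | linarith
      _ ≤ _ := by
          simp only [ENNReal.rpow_one, add_assoc]
          exact le_self_add
  · calc A ^ a * B ^ b ≤ truncPow ε A * 1 := by
          gcongr
          · exact rpow_le_truncPow hε haε hA
          · exact ENNReal.rpow_le_one hB hb.le
      _ ≤ _ := by
          rw [mul_one, add_right_comm]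
          exact le_add_self
  · calc A ^ a * B ^ b ≤ 1 * truncPow ε B := by
          gcongr
          · exact ENNReal.rpow_le_one hA ha.le
          · exact rpow_le_truncPow hε hbε hB
      _ ≤ _ := by
          rw [one_mul]
          exact le_add_self
  · rcases le_total A B with h | h
    · calc A ^ a * B ^ b ≤ B ^ a * B ^ b := by gcongr
        _ = B ^ (a + b) := (ENNReal.rpow_add_of_nonneg _ _ ha.le hb.le).symm
        _ ≤ truncPow ε B := rpow_le_truncPow' hε hab hB
        _ ≤ _ := le_add_self
    · calc A ^ a * B ^ b ≤ A ^ a * A ^ b := by gcongr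
        _ = A ^ (a + b) := (ENNReal.rpow_add_of_nonneg _ _ ha.le hb.le).symm
        _ ≤ truncPow ε A := rpow_le_truncPow' hε hab hA
        _ ≤ _ := by
          rw [add_right_comm]
          exact le_add_self

/-- The inequality at distance `r`, obtained from `rpow_mul_rpow_le_mul_add_truncPow` by
homogeneity. -/
lemma rpow_mul_rpow_mul_rpow_le {a b ε : ℝ} (ha : 0 < a) (hb : 0 < b) (hε : 0 ≤ ε)
    (hab : 1 + ε ≤ a + b) (haε : a ≤ 1 - ε) (hbε : b ≤ 1 - ε) (A B : ℝ≥0∞) {r : ℝ≥0∞}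
    (hr : r ≠ 0) (hr' : r ≠ ∞) :
    A ^ a * B ^ b * r ^ (a + b - 2) ≤
      A * B + r ^ (-2 : ℝ) * truncPow ε (A * r) + r ^ (-2 : ℝ) * truncPow ε (B * r) := by
  have key := rpow_mul_rpow_le_mul_add_truncPow ha hb hε hab haε hbε (A * r) (B * r)
  rw [ENNReal.mul_rpow_of_nonneg _ _ ha.le, ENNReal.mul_rpow_of_nonneg _ _ hb.le] at key
  calc A ^ a * B ^ b * r ^ (a + b - 2)
      = r ^ (-2 : ℝ) * (A ^ a * r ^ a * (B ^ b * r ^ b)) := by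
        rw [show a + b - 2 = a + b + -2 by ring, ENNReal.rpow_add _ _ hr hr',
          ENNReal.rpow_add _ _ hr hr']
        ring
    _ ≤ r ^ (-2 : ℝ) * (A * r * (B * r) + truncPow ε (A * r) + truncPow ε (B * r)) := by
        gcongr
    _ = _ := by
        rw [mul_add, mul_add]
        congr 2
        have : r ^ (-2 : ℝ) * (r * r) = 1 := by
          have h2 : r * r = r ^ (2 : ℝ) := by rw [ENNReal.rpow_ofNat, sq]
          rw [h2, ← ENNReal.rpow_add _ _ hr hr']
          norm_num
        calc r ^ (-2 : ℝ) * (A * r * (B * r)) = A * B * (r ^ (-2 : ℝ) * (r * r)) := by ring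
          _ = A * B := by rw [this, mul_one]

open Set in
/-- Splitting at `r = 1 / A` gives two convergent power integrals of the same size `A / ε`. -/
lemma lintegral_rpow_neg_two_mul_truncPow_le {ε : ℝ} (hε : 0 < ε) (hε1 : ε < 1) (A : ℝ≥0∞) :
    ∫⁻ r in Ioi (0 : ℝ), ENNReal.ofReal r ^ (-2 : ℝ) * truncPow ε (A * ENNReal.ofReal r)
      ≤ ENNReal.ofReal (2 / ε) * A := by
  rcases eq_or_ne A 0 with rfl | hA0
  · have : truncPow ε 0 = 0 := by
      simp [truncPow, ENNReal.zero_rpow_of_pos (show 0 < 1 + ε by linarith)]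
    simp [this]
  rcases eq_or_ne A ∞ with rfl | hA
  · rw [ENNReal.mul_top (by simpa using hε)]
    exact le_top
  lift A to ℝ≥0 using hA
  set t : ℝ := (A : ℝ) with ht
  have ht0 : 0 < t := by
    have : A ≠ 0 := by simpa using hA0
    exact NNReal.coe_pos.2 (pos_iff_ne_zero.2 this)
  have hA' : (A : ℝ≥0∞) = ENNReal.ofReal t := (ENNReal.ofReal_coe_nnreal).symm
  have hc : 0 < 1 / t := by positivity
  have hpt : ∀ r : ℝ, 0 < r → ENNReal.ofReal r ^ (-2 : ℝ) * truncPow ε (A * ENNReal.ofReal r) ≤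
      min (ENNReal.ofReal (t ^ (1 + ε) * r ^ (ε - 1)))
        (ENNReal.ofReal (t ^ (1 - ε) * r ^ (-ε - 1))) := by
    intro r hr
    have aux : ∀ c : ℝ, 0 < c → ENNReal.ofReal r ^ (-2 : ℝ) * (A * ENNReal.ofReal r) ^ c =
        ENNReal.ofReal (t ^ c * r ^ (c - 2)) := by
      intro c hc
      rw [hA', ← ENNReal.ofReal_mul ht0.le, ENNReal.ofReal_rpow_of_pos hr,
        ENNReal.ofReal_rpow_of_pos (by positivity), ← ENNReal.ofReal_mul (by positivity),
        Real.mul_rpow ht0.le hr.le, sub_eq_add_neg, Real.rpow_add hr]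
      congr 1
      ring
    refine le_min ?_ ?_
    · calc _ ≤ ENNReal.ofReal r ^ (-2 : ℝ) * (A * ENNReal.ofReal r) ^ (1 + ε) := by
            gcongr
            exact min_le_left _ _
        _ = _ := by
            rw [aux _ (by linarith)]
            congr 3
            ring
    · calc _ ≤ ENNReal.ofReal r ^ (-2 : ℝ) * (A * ENNReal.ofReal r) ^ (1 - ε) := by
            gcongr
            exact min_le_right _ _
        _ = _ := by
            rw [aux _ (by linarith)]
            congr 3
            ring
  rw [← Ioc_union_Ioi_eq_Ioi hc.le, lintegral_union measurableSet_Ioi (Ioc_disjoint_Ioi le_rfl)]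
  have h1 : ∫⁻ r in Ioc 0 (1 / t),
      ENNReal.ofReal r ^ (-2 : ℝ) * truncPow ε (A * ENNReal.ofReal r)
        ≤ ENNReal.ofReal (t / ε) := by
    calc _ ≤ ∫⁻ r in Ioc 0 (1 / t), ENNReal.ofReal (t ^ (1 + ε) * r ^ (ε - 1)) :=
          setLIntegral_mono' measurableSet_Ioc fun r hr => (hpt r hr.1).trans (min_le_left _ _)
      _ = ENNReal.ofReal (∫ r in Ioc 0 (1 / t), t ^ (1 + ε) * r ^ (ε - 1)) := by
          rw [ofReal_integral_eq_lintegral_ofReal]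
          · exact ((intervalIntegral.intervalIntegrable_rpow' (by linarith)).1).const_mul _
          · filter_upwards [ae_restrict_mem measurableSet_Ioc] with r hr
            have := hr.1
            positivity
      _ = _ := by
          rw [← intervalIntegral.integral_of_le hc.le, intervalIntegral.integral_const_mul,
            integral_rpow (Or.inl (by linarith)), sub_add_cancel, Real.zero_rpow hε.ne', one_div,
            Real.inv_rpow ht0.le, Real.rpow_add ht0, Real.rpow_one]
          congr 1
          have := (Real.rpow_pos_of_pos ht0 ε).ne'
          field_simp
          simp
  have h2 : ∫⁻ r in Ioi (1 / t),
      ENNReal.ofReal r ^ (-2 : ℝ) * truncPow ε (A * ENNReal.ofReal r)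
        ≤ ENNReal.ofReal (t / ε) := by
    calc _ ≤ ∫⁻ r in Ioi (1 / t), ENNReal.ofReal (t ^ (1 - ε) * r ^ (-ε - 1)) :=
          setLIntegral_mono' measurableSet_Ioi fun r hr =>
            (hpt r (hc.trans hr)).trans (min_le_right _ _)
      _ = ENNReal.ofReal (∫ r in Ioi (1 / t), t ^ (1 - ε) * r ^ (-ε - 1)) := by
          rw [ofReal_integral_eq_lintegral_ofReal]
          · exact (integrableOn_Ioi_rpow_of_lt (by linarith) hc).const_mul _
          · filter_upwards [ae_restrict_mem measurableSet_Ioi] with r hr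
            have : 0 < r := hc.trans hr
            positivity
      _ = _ := by
          rw [integral_const_mul, integral_Ioi_rpow_of_lt (by linarith) hc, sub_add_cancel,
            one_div, Real.inv_rpow ht0.le, Real.rpow_neg ht0.le, inv_inv, Real.rpow_sub ht0,
            Real.rpow_one]
          congr 1
          have := (Real.rpow_pos_of_pos ht0 ε).ne'
          field_simp
  calc _ ≤ ENNReal.ofReal (t / ε) + ENNReal.ofReal (t / ε) := add_le_add h1 h2
    _ = _ := by
        rw [hA', ← ENNReal.ofReal_add (by positivity) (by positivity),
          ← ENNReal.ofReal_mul (by positivity)]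
        congr 1
        ring

/-! ### The volume of the ball through a point -/

section RadialVolume

variable {E : Type*} [NormedAddCommGroup E] [NormedSpace ℝ E] [MeasurableSpace E]

/-- The measure of the ball centred at the origin whose boundary contains `x`. Measuring
distances by this quantity removes the dimension from all formulas. -/
noncomputable def ballVolume (μ : Measure E) (x : E) : ℝ :=
  μ.real (Metric.ball 0 1) * ‖x‖ ^ Module.finrank ℝ E

lemma ballVolume_sub_comm (μ : Measure E) (x y : E) :
    ballVolume μ (x - y) = ballVolume μ (y - x) := by
  rw [ballVolume, ballVolume, norm_sub_rev]

lemma ballVolume_nonneg (μ : Measure E) (x : E) : 0 ≤ ballVolume μ x := by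
  unfold ballVolume
  positivity

lemma measurable_ballVolume [BorelSpace E] (μ : Measure E) : Measurable (ballVolume μ) := by
  unfold ballVolume
  fun_prop

variable [FiniteDimensional ℝ E] (μ : Measure E) [μ.IsAddHaarMeasure]

lemma unitBall_measureReal_pos : 0 < μ.real (Metric.ball (0 : E) 1) :=
  ENNReal.toReal_pos (Metric.measure_ball_pos μ 0 one_pos).ne' measure_ball_lt_top.ne

lemma ballVolume_pos {x : E} (hx : x ≠ 0) : 0 < ballVolume μ x := by
  have := unitBall_measureReal_pos μ
  have := norm_pos_iff.2 hx
  unfold ballVolume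
  positivity

variable [BorelSpace E]

open Set Metric in
lemma measure_ballVolume_le [Nontrivial E] (t : ℝ) :
    μ {x | ballVolume μ x ≤ t} = ENNReal.ofReal t := by
  have hV := unitBall_measureReal_pos μ
  have hd : Module.finrank ℝ E ≠ 0 := Module.finrank_pos.ne'
  rcases lt_or_ge t 0 with ht | ht
  · rw [ENNReal.ofReal_of_nonpos ht.le, measure_eq_zero_iff_ae_notMem]
    exact .of_forall fun x hx => (ballVolume_nonneg μ x).not_gt (lt_of_le_of_lt hx ht)
  · set R : ℝ := (t / μ.real (ball 0 1)) ^ ((Module.finrank ℝ E : ℝ)⁻¹) with hR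
    have hR0 : 0 ≤ R := by positivity
    have hRpow : R ^ Module.finrank ℝ E = t / μ.real (ball 0 1) :=
      Real.rpow_inv_natCast_pow (by positivity) hd
    have : {x | ballVolume μ x ≤ t} = closedBall (0 : E) R := by
      ext x
      rw [mem_ofPred_eq, mem_closedBall_zero_iff, ballVolume, mul_comm, ← le_div_iff₀ hV, ← hRpow,
        pow_le_pow_iff_left₀ (norm_nonneg x) hR0 hd]
    rw [this, Measure.addHaar_closedBall _ _ hR0, hRpow, ENNReal.ofReal_div_of_pos hV,
      measureReal_def, ENNReal.ofReal_toReal measure_ball_lt_top.ne]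
    exact ENNReal.div_mul_cancel (measure_ball_pos μ 0 one_pos).ne' measure_ball_lt_top.ne

open Set in
/-- The volume of the ball through a point is distributed according to Lebesgue measure on the
half-line, whatever the space. -/
lemma map_ballVolume [Nontrivial E] : μ.map (ballVolume μ) = volume.restrict (Ioi 0) := by
  refine (Measure.ext_of_Ioc _ _ fun a b hab => ?_).symm
  have hm : ∀ t, MeasurableSet {x | ballVolume μ x ≤ t} := fun t =>
    measurable_ballVolume μ measurableSet_Iic
  have hsub : {x | ballVolume μ x ≤ a} ⊆ {x | ballVolume μ x ≤ b} :=
    fun x (hx : ballVolume μ x ≤ a) => hx.trans hab.le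
  have hpre : ballVolume μ ⁻¹' Ioc a b = {x | ballVolume μ x ≤ b} \ {x | ballVolume μ x ≤ a} := by
    ext x
    simp [and_comm]
  rw [Measure.map_apply (measurable_ballVolume μ) measurableSet_Ioc, hpre,
    measure_sdiff hsub (hm a).nullMeasurableSet
      (by rw [measure_ballVolume_le]; exact ENNReal.ofReal_ne_top),
    measure_ballVolume_le, measure_ballVolume_le, Measure.restrict_apply measurableSet_Ioc,
    Ioc_inter_Ioi, Real.volume_Ioc]
  rcases le_total a 0 with ha | ha
  · rw [sup_eq_right.2 ha, ENNReal.ofReal_of_nonpos ha]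
    simp
  · rw [sup_eq_left.2 ha, ENNReal.ofReal_sub _ ha]

lemma lintegral_comp_ballVolume [Nontrivial E] {φ : ℝ → ℝ≥0∞} (hφ : Measurable φ) :
    ∫⁻ x, φ (ballVolume μ x) ∂μ = ∫⁻ r in Set.Ioi 0, φ r := by
  rw [← map_ballVolume μ, lintegral_map hφ (measurable_ballVolume μ)]

end RadialVolume

/-! ### The bilinear form of the Hardy–Littlewood–Sobolev inequality -/

/-- The kernel `k` satisfies `∬ f(u) h(x) k(x - u) du dx ≤ C ‖f‖_p ‖h‖_s` for all nonnegative
measurable `f`, `h`. -/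
def BilinearBound {E : Type*} [Sub E] [MeasurableSpace E] (μ : Measure E) (k : E → ℝ≥0∞)
    (p s : ℝ) (C : ℝ≥0∞) : Prop :=
  ∀ f h : E → ℝ≥0∞, Measurable f → Measurable h →
    ∫⁻ u, ∫⁻ x, f u * h x * k (x - u) ∂μ ∂μ ≤
      C * ((∫⁻ u, f u ^ p ∂μ) ^ (1 / p) * (∫⁻ x, h x ^ s ∂μ) ^ (1 / s))

section Euclidean

variable {E : Type*} [NormedAddCommGroup E] [NormedSpace ℝ E] [MeasurableSpace E] [BorelSpace E]
  [FiniteDimensional ℝ E] [Nontrivial E] (μ : Measure E) [μ.IsAddHaarMeasure]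

lemma lintegral_truncPow_ballVolume_le {ε : ℝ} (hε : 0 < ε) (hε1 : ε < 1) (A : ℝ≥0∞) (u : E) :
    ∫⁻ x, ENNReal.ofReal (ballVolume μ (x - u)) ^ (-2 : ℝ) *
      truncPow ε (A * ENNReal.ofReal (ballVolume μ (x - u))) ∂μ ≤ ENNReal.ofReal (2 / ε) * A := by
  have hm : Measurable fun r : ℝ =>
      ENNReal.ofReal r ^ (-2 : ℝ) * truncPow ε (A * ENNReal.ofReal r) := by
    have := measurable_truncPow ε
    fun_prop
  rw [lintegral_sub_right_eq_self (fun x => ENNReal.ofReal (ballVolume μ x) ^ (-2 : ℝ) *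
    truncPow ε (A * ENNReal.ofReal (ballVolume μ x))) u, lintegral_comp_ballVolume μ hm]
  exact lintegral_rpow_neg_two_mul_truncPow_le hε hε1 A

/-- The inequality before normalization, for densities `A = f ^ p` and `B = h ^ s`: it is not
homogeneous in `A` and `B`, and is meant for `∫ A = ∫ B = 1`. -/
lemma lintegral_rpow_mul_rpow_le {a b ε : ℝ} (ha : 0 < a) (hb : 0 < b) (hε : 0 < ε)
    (hab : 1 + ε ≤ a + b) (haε : a ≤ 1 - ε) (hbε : b ≤ 1 - ε) {A B : E → ℝ≥0∞}
    (hA : Measurable A) (hB : Measurable B) :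
    ∫⁻ u, ∫⁻ x, A u ^ a * B x ^ b * ENNReal.ofReal (ballVolume μ (x - u)) ^ (a + b - 2) ∂μ ∂μ ≤
      (∫⁻ u, A u ∂μ) * (∫⁻ x, B x ∂μ) + ENNReal.ofReal (2 / ε) * (∫⁻ u, A u ∂μ) +
        ENNReal.ofReal (2 / ε) * (∫⁻ x, B x ∂μ) := by
  have hε1 : ε < 1 := by linarith
  have hρ := measurable_ballVolume μ
  have hn := measurable_truncPow ε
  obtain ⟨T, hT⟩ : ∃ T : ℝ≥0∞ → E → ℝ≥0∞, ∀ t z, T t z =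
      ENNReal.ofReal (ballVolume μ z) ^ (-2 : ℝ) *
        truncPow ε (t * ENNReal.ofReal (ballVolume μ z)) := ⟨_, fun _ _ => rfl⟩
  have hTm : Measurable (Function.uncurry T) := by
    simp only [hT, Function.uncurry_def]
    fun_prop
  have hT1 : Measurable fun z : E × E => T (A z.1) (z.2 - z.1) :=
    hTm.comp (by fun_prop : Measurable fun z : E × E => (A z.1, z.2 - z.1))
  have hT2 : Measurable fun z : E × E => T (B z.2) (z.2 - z.1) :=
    hTm.comp (by fun_prop : Measurable fun z : E × E => (B z.2, z.2 - z.1))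
  calc _ ≤ ∫⁻ u, ∫⁻ x, (A u * B x + T (A u) (x - u) + T (B x) (x - u)) ∂μ ∂μ := by
        refine lintegral_mono fun u => lintegral_mono_ae ?_
        have hne : ∀ᵐ x ∂μ, x ≠ u := by simp [ae_iff, measure_singleton]
        filter_upwards [hne] with x hx
        rw [hT, hT]
        exact rpow_mul_rpow_mul_rpow_le ha hb hε.le hab haε hbε _ _
          (by simpa using ballVolume_pos μ (sub_ne_zero.2 hx)) ENNReal.ofReal_ne_top
    _ = ∫⁻ z, (A z.1 * B z.2 + T (A z.1) (z.2 - z.1) + T (B z.2) (z.2 - z.1)) ∂μ.prod μ := by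
        rw [lintegral_prod]
        fun_prop
    _ = (∫⁻ z, A z.1 * B z.2 ∂μ.prod μ) + (∫⁻ z, T (A z.1) (z.2 - z.1) ∂μ.prod μ) +
          ∫⁻ z, T (B z.2) (z.2 - z.1) ∂μ.prod μ := by
        rw [lintegral_add_right _ hT2, lintegral_add_right _ hT1]
    _ ≤ _ := by
        gcongr
        · rw [lintegral_prod_mul hA.aemeasurable hB.aemeasurable]
        · rw [lintegral_prod _ hT1.aemeasurable, ← lintegral_const_mul _ hA]
          refine lintegral_mono fun u => ?_
          simp only [hT]
          exact lintegral_truncPow_ballVolume_le μ hε hε1 _ u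
        · rw [lintegral_prod_symm _ hT2.aemeasurable, ← lintegral_const_mul _ hB]
          refine lintegral_mono fun x => ?_
          simp only [hT, ballVolume_sub_comm μ x]
          exact lintegral_truncPow_ballVolume_le μ hε hε1 _ x

/-- The Hardy–Littlewood–Sobolev inequality with the distance measured by `ballVolume`. The
constant does not depend on the space. -/
theorem bilinearBound_ballVolume {p s ε : ℝ} (hp : 0 < p) (hs : 0 < s) (hε : 0 < ε)
    (hps : 1 + ε ≤ 1 / p + 1 / s) (hpε : 1 / p ≤ 1 - ε) (hsε : 1 / s ≤ 1 - ε) :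
    BilinearBound μ (fun x => ENNReal.ofReal (ballVolume μ x) ^ (1 / p + 1 / s - 2)) p s
      (1 + ENNReal.ofReal (2 / ε) + ENNReal.ofReal (2 / ε)) := by
  intro f h hf hh
  have hρ := measurable_ballVolume μ
  have hp' : 0 < 1 / p := by positivity
  have hs' : 0 < 1 / s := by positivity
  have root : ∀ {r : ℝ}, 0 < r → ∀ t : ℝ≥0∞, (t ^ r) ^ (1 / r) = t := fun hr t => by
    rw [← ENNReal.rpow_mul, mul_one_div_cancel hr.ne', ENNReal.rpow_one]
  set P := ∫⁻ u, f u ^ p ∂μ with hP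
  set S := ∫⁻ x, h x ^ s ∂μ with hS
  rcases eq_or_ne P 0 with hP0 | hP0
  · have h0 : ∀ᵐ u ∂μ, f u = 0 := by
      filter_upwards [(lintegral_eq_zero_iff (by fun_prop)).1 hP0] with u hu
      simpa [hp, hp.not_gt] using hu
    rw [lintegral_congr_ae (g := fun _ => 0) (by filter_upwards [h0] with u hu; simp [hu])]
    simp
  rcases eq_or_ne S 0 with hS0 | hS0
  · have h0 : ∀ᵐ x ∂μ, h x = 0 := by
      filter_upwards [(lintegral_eq_zero_iff (by fun_prop)).1 hS0] with u hu
      simpa [hs, hs.not_gt] using hu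
    have : ∀ u, ∫⁻ x, f u * h x * ENNReal.ofReal (ballVolume μ (x - u)) ^ (1 / p + 1 / s - 2) ∂μ
        = 0 := fun u => by
      rw [lintegral_congr_ae (g := fun _ => 0) (by filter_upwards [h0] with x hx; simp [hx])]
      simp
    simp only [this, lintegral_zero]
    exact zero_le
  have hC : (1 + ENNReal.ofReal (2 / ε) + ENNReal.ofReal (2 / ε)) ≠ 0 := by simp
  have hP1 : P ^ (1 / p) ≠ 0 := by simp [hP0, hp.not_gt, hp]
  have hS1 : S ^ (1 / s) ≠ 0 := by simp [hS0, hs.not_gt, hs]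
  rcases eq_or_ne P ∞ with hPt | hPt
  · rw [hPt, ENNReal.top_rpow_of_pos hp', ENNReal.top_mul hS1, ENNReal.mul_top hC]
    exact le_top
  rcases eq_or_ne S ∞ with hSt | hSt
  · rw [hSt, ENNReal.top_rpow_of_pos hs', ENNReal.mul_top hP1, ENNReal.mul_top hC]
    exact le_top
  -- The remaining case reduces to `P = S = 1` by dividing the densities by their integrals.
  have key := lintegral_rpow_mul_rpow_le μ hp' hs' hε hps hpε hsε
    (A := fun u => P⁻¹ * f u ^ p) (B := fun x => S⁻¹ * h x ^ s) (by fun_prop) (by fun_prop)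
  rw [lintegral_const_mul _ (by fun_prop), lintegral_const_mul _ (by fun_prop), ← hP, ← hS,
    ENNReal.inv_mul_cancel hP0 hPt, ENNReal.inv_mul_cancel hS0 hSt] at key
  simp only [mul_one] at key
  have scale : ∀ {T : ℝ≥0∞} {r : ℝ}, 0 < r → T ≠ 0 → T ≠ ∞ → ∀ t : ℝ≥0∞,
      t = T ^ (1 / r) * (T⁻¹ * t ^ r) ^ (1 / r) := by
    intro T r hr hT hT' t
    have hr' : 0 ≤ 1 / r := by positivity
    rw [ENNReal.mul_rpow_of_nonneg _ _ hr', root hr, ← mul_assoc,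
      ← ENNReal.mul_rpow_of_nonneg _ _ hr', ENNReal.mul_inv_cancel hT hT', ENNReal.one_rpow,
      one_mul]
  calc ∫⁻ u, ∫⁻ x, f u * h x * ENNReal.ofReal (ballVolume μ (x - u)) ^ (1 / p + 1 / s - 2) ∂μ ∂μ
      = ∫⁻ u, ∫⁻ x, P ^ (1 / p) * S ^ (1 / s) * ((P⁻¹ * f u ^ p) ^ (1 / p) *
          (S⁻¹ * h x ^ s) ^ (1 / s) *
          ENNReal.ofReal (ballVolume μ (x - u)) ^ (1 / p + 1 / s - 2)) ∂μ ∂μ := by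
        refine lintegral_congr fun u => lintegral_congr fun x => ?_
        nth_rewrite 1 [scale hp hP0 hPt (f u), scale hs hS0 hSt (h x)]
        ring
    _ = P ^ (1 / p) * S ^ (1 / s) * ∫⁻ u, ∫⁻ x, (P⁻¹ * f u ^ p) ^ (1 / p) *
          (S⁻¹ * h x ^ s) ^ (1 / s) *
          ENNReal.ofReal (ballVolume μ (x - u)) ^ (1 / p + 1 / s - 2) ∂μ ∂μ := by
        rw [← lintegral_const_mul]
        · refine lintegral_congr fun u => ?_
          rw [lintegral_const_mul]
          fun_prop
        · refine Measurable.lintegral_prod_right (f := fun u x => (P⁻¹ * f u ^ p) ^ (1 / p) *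
            (S⁻¹ * h x ^ s) ^ (1 / s) *
            ENNReal.ofReal (ballVolume μ (x - u)) ^ (1 / p + 1 / s - 2)) ?_
          simp only [Function.uncurry_def]
          fun_prop
    _ ≤ P ^ (1 / p) * S ^ (1 / s) * (1 + ENNReal.ofReal (2 / ε) + ENNReal.ofReal (2 / ε)) := by
        gcongr
    _ = _ := mul_comm _ _

end Euclidean

lemma BilinearBound.const_mul {E : Type*} [AddGroup E] [MeasurableSpace E] [MeasurableSub₂ E]
    {μ : Measure E} [SFinite μ] {k : E → ℝ≥0∞} {p s : ℝ} {C : ℝ≥0∞} (hk : Measurable k)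
    (h : BilinearBound μ k p s C) (c : ℝ≥0∞) :
    BilinearBound μ (fun x => c * k x) p s (c * C) := by
  intro f g hf hg
  calc ∫⁻ u, ∫⁻ x, f u * g x * (c * k (x - u)) ∂μ ∂μ
      = ∫⁻ u, ∫⁻ x, c * (f u * g x * k (x - u)) ∂μ ∂μ := by
        refine lintegral_congr fun u => lintegral_congr fun x => ?_
        ring
    _ = c * ∫⁻ u, ∫⁻ x, f u * g x * k (x - u) ∂μ ∂μ := by
        rw [← lintegral_const_mul]
        · refine lintegral_congr fun u => ?_
          rw [lintegral_const_mul]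
          fun_prop
        · refine Measurable.lintegral_prod_right (f := fun u x => f u * g x * k (x - u)) ?_
          simp only [Function.uncurry_def]
          fun_prop
    _ ≤ _ := by
        rw [mul_assoc]
        gcongr
        exact h f g hf hg

/-- Bilinear bounds tensorize: apply the second one on the fibres, then the first one to the
fibrewise norms. -/
theorem BilinearBound.prod {E F : Type*} [AddGroup E] [AddGroup F] [MeasurableSpace E]
    [MeasurableSpace F] [MeasurableSub₂ E] [MeasurableSub₂ F] {μ : Measure E} {ν : Measure F}
    [SFinite μ] [SFinite ν] {k : E → ℝ≥0∞} {l : F → ℝ≥0∞} {p s : ℝ} {C D : ℝ≥0∞}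
    (hp : 0 < p) (hs : 0 < s) (hk : Measurable k) (hl : Measurable l)
    (h₁ : BilinearBound μ k p s C) (h₂ : BilinearBound ν l p s D) :
    BilinearBound (μ.prod ν) (fun z => k z.1 * l z.2) p s (C * D) := by
  intro f h hf hh
  have root : ∀ {r : ℝ}, 0 < r → ∀ t : ℝ≥0∞, (t ^ (1 / r)) ^ r = t := fun hr t => by
    rw [← ENNReal.rpow_mul, one_div_mul_cancel hr.ne', ENNReal.rpow_one]
  set F' : E → ℝ≥0∞ := fun u => (∫⁻ v, f (u, v) ^ p ∂ν) ^ (1 / p) with hF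
  set H' : E → ℝ≥0∞ := fun x => (∫⁻ y, h (x, y) ^ s ∂ν) ^ (1 / s) with hH
  have hFm : Measurable F' :=
    (Measurable.lintegral_prod_right' (f := fun z => f z ^ p) (by fun_prop)).pow_const _
  have hHm : Measurable H' :=
    (Measurable.lintegral_prod_right' (f := fun z => h z ^ s) (by fun_prop)).pow_const _
  have hF' : ∫⁻ u, F' u ^ p ∂μ = ∫⁻ z, f z ^ p ∂μ.prod ν := by
    simp only [hF, root hp]
    rw [lintegral_prod _ (by fun_prop)]
  have hH' : ∫⁻ x, H' x ^ s ∂μ = ∫⁻ z, h z ^ s ∂μ.prod ν := by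
    simp only [hH, root hs]
    rw [lintegral_prod _ (by fun_prop)]
  calc ∫⁻ w, ∫⁻ z, f w * h z * (k (z - w).1 * l (z - w).2) ∂μ.prod ν ∂μ.prod ν
      = ∫⁻ u, ∫⁻ v, ∫⁻ x, ∫⁻ y,
          f (u, v) * h (x, y) * (k (x - u) * l (y - v)) ∂ν ∂μ ∂ν ∂μ := by
        rw [lintegral_prod]
        · refine lintegral_congr fun u => lintegral_congr fun v => ?_
          rw [lintegral_prod]
          · rfl
          · fun_prop
        · refine (Measurable.lintegral_prod_right (f := fun w z =>
            f w * h z * (k (z - w).1 * l (z - w).2)) ?_).aemeasurable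
          simp only [Function.uncurry_def]
          fun_prop
    _ = ∫⁻ u, ∫⁻ x, ∫⁻ v, ∫⁻ y,
          f (u, v) * h (x, y) * (k (x - u) * l (y - v)) ∂ν ∂ν ∂μ ∂μ := by
        refine lintegral_congr fun u => ?_
        rw [lintegral_lintegral_swap]
        simp only [Function.uncurry_def]
        refine (Measurable.lintegral_prod_right (f := fun (z : F × E) y =>
          f (u, z.1) * h (z.2, y) * (k (z.2 - u) * l (y - z.1))) ?_).aemeasurable
        simp only [Function.uncurry_def]
        fun_prop
    _ = ∫⁻ u, ∫⁻ x, k (x - u) * ∫⁻ v, ∫⁻ y,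
          f (u, v) * h (x, y) * l (y - v) ∂ν ∂ν ∂μ ∂μ := by
        refine lintegral_congr fun u => lintegral_congr fun x => ?_
        rw [← lintegral_const_mul]
        · refine lintegral_congr fun v => ?_
          rw [← lintegral_const_mul _ (by fun_prop)]
          refine lintegral_congr fun y => ?_
          ring
        · refine Measurable.lintegral_prod_right (f := fun v y =>
            f (u, v) * h (x, y) * l (y - v)) ?_
          simp only [Function.uncurry_def]
          fun_prop
    _ ≤ ∫⁻ u, ∫⁻ x, k (x - u) * (D * (F' u * H' x)) ∂μ ∂μ := by
        gcongr with u x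
        exact h₂ (fun v => f (u, v)) (fun y => h (x, y)) (by fun_prop) (by fun_prop)
    _ = ∫⁻ u, ∫⁻ x, D * F' u * H' x * k (x - u) ∂μ ∂μ := by
        refine lintegral_congr fun u => lintegral_congr fun x => ?_
        ring
    _ ≤ C * ((∫⁻ u, (D * F' u) ^ p ∂μ) ^ (1 / p) * (∫⁻ x, H' x ^ s ∂μ) ^ (1 / s)) :=
        h₁ _ _ (by fun_prop) hHm
    _ = _ := by
        simp only [ENNReal.mul_rpow_of_nonneg _ _ hp.le]
        rw [lintegral_const_mul _ (by fun_prop), hF', hH',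
          ENNReal.mul_rpow_of_nonneg _ _ (by positivity), ← ENNReal.rpow_mul,
          mul_one_div_cancel hp.ne', ENNReal.rpow_one]
        ring

/-! ### From the bilinear form to the operator -/

/-- The converse of Hölder's inequality for nonnegative functions. -/
lemma lintegral_rpow_le_of_forall_lintegral_mul_le {α : Type*} [MeasurableSpace α] {μ : Measure α}
    [SigmaFinite μ] {q s : ℝ} (hqs : q.HolderConjugate s) {G : α → ℝ≥0∞} {M : ℝ≥0∞}
    (hM : ∀ h : α → ℝ≥0∞, Measurable h → ∫⁻ x, G x * h x ∂μ ≤ M * (∫⁻ x, h x ^ s ∂μ) ^ (1 / s)) :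
    (∫⁻ x, G x ^ q ∂μ) ^ (1 / q) ≤ M := by
  have hq := hqs.pos
  have hs := hqs.symm.pos
  rw [one_div, ENNReal.rpow_inv_le_iff hq]
  refine le_of_forall_lt fun L hL => ?_
  -- It suffices to test against powers of simple functions of finite integral below `G ^ q`.
  rw [lintegral_eq_nnreal] at hL
  simp only [lt_iSup_iff] at hL
  obtain ⟨g₀, hg₀, hL⟩ := hL
  rw [← SimpleFunc.lintegral_eq_lintegral] at hL
  obtain ⟨g, hg, hgfin, hLg⟩ := SimpleFunc.exists_lt_lintegral_simpleFunc_of_lt_lintegral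
    (f := g₀) (by simpa using hL)
  refine hLg.trans_le ?_
  have hgm : Measurable fun x => (g x : ℝ≥0∞) := g.measurable.coe_nnreal_ennreal
  set I := ∫⁻ x, (g x : ℝ≥0∞) ∂μ with hI
  rcases eq_or_ne I 0 with h0 | h0
  · simp [h0]
  have hle : I ≤ M * I ^ (1 / s) := by
    calc I ≤ ∫⁻ x, G x * (g x : ℝ≥0∞) ^ (1 / s) ∂μ := by
          refine lintegral_mono fun x => ?_
          have hx : (g x : ℝ≥0∞) ≤ G x ^ q := (ENNReal.coe_le_coe.2 (hg x)).trans (hg₀ x)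
          have hx' : (g x : ℝ≥0∞) ^ (1 / q) ≤ G x := by
            rwa [one_div, ENNReal.rpow_inv_le_iff hq]
          calc (g x : ℝ≥0∞) = (g x : ℝ≥0∞) ^ (1 / q) * (g x : ℝ≥0∞) ^ (1 / s) := by
                rw [← ENNReal.rpow_add_of_nonneg _ _ (by positivity) (by positivity), one_div,
                  one_div, hqs.inv_add_inv_eq_one, ENNReal.rpow_one]
            _ ≤ _ := by gcongr
      _ ≤ M * (∫⁻ x, ((g x : ℝ≥0∞) ^ (1 / s)) ^ s ∂μ) ^ (1 / s) := hM _ (by fun_prop)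
      _ = _ := by
          simp only [← ENNReal.rpow_mul, one_div_mul_cancel hs.ne', ENNReal.rpow_one, hI]
  rw [← ENNReal.rpow_inv_le_iff hq]
  have hI0 : I ^ (1 / s) ≠ 0 := by simp [h0, hs, hs.not_gt]
  have hIt : I ^ (1 / s) ≠ ∞ := ENNReal.rpow_ne_top_of_nonneg (by positivity) hgfin.ne
  have : I ^ q⁻¹ * I ^ (1 / s) ≤ M * I ^ (1 / s) := by
    rwa [← ENNReal.rpow_add_of_nonneg _ _ (by positivity) (by positivity), one_div,
      hqs.inv_add_inv_eq_one, ENNReal.rpow_one, ← one_div]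
  exact (ENNReal.mul_le_mul_iff_left hI0 hIt).1 this

/-- By duality, a bilinear bound with `s` conjugate to `q` is an `L^p → L^q` bound for convolution
with the kernel. -/
theorem BilinearBound.operator {E : Type*} [AddGroup E] [MeasurableSpace E] [MeasurableSub₂ E]
    {μ : Measure E} [SigmaFinite μ] {k : E → ℝ≥0∞} {p q s : ℝ} {C : ℝ≥0∞}
    (hqs : q.HolderConjugate s) (hk : Measurable k) (hb : BilinearBound μ k p s C)
    {f : E → ℝ≥0∞} (hf : Measurable f) :
    (∫⁻ x, (∫⁻ u, f u * k (x - u) ∂μ) ^ q ∂μ) ^ (1 / q) ≤ C * (∫⁻ u, f u ^ p ∂μ) ^ (1 / p) := by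
  refine lintegral_rpow_le_of_forall_lintegral_mul_le hqs fun h hh => ?_
  calc ∫⁻ x, (∫⁻ u, f u * k (x - u) ∂μ) * h x ∂μ
      = ∫⁻ x, ∫⁻ u, f u * h x * k (x - u) ∂μ ∂μ := by
        refine lintegral_congr fun x => ?_
        rw [← lintegral_mul_const _ (by fun_prop)]
        refine lintegral_congr fun u => ?_
        ring
    _ = ∫⁻ u, ∫⁻ x, f u * h x * k (x - u) ∂μ ∂μ := by
        rw [lintegral_lintegral_swap]
        simp only [Function.uncurry_def]
        fun_prop
    _ ≤ _ := by
        rw [mul_assoc]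
        exact hb f h hf hh

/-! ### A bound uniform in the dimensions and the orders -/

/-- The volume of the Euclidean unit ball is bounded in the dimension: passing from `m` to
`m + 2` multiplies it by `π / (m / 2 + 1)`, which is at most `1` once `m ≥ 5`. -/
lemma exists_unitBall_volume_le : ∃ W : ℝ, 1 ≤ W ∧ ∀ m : ℕ, m ≠ 0 →
    (volume : Measure (EuclideanSpace ℝ (Fin m))).real (Metric.ball 0 1) ≤ W := by
  set v : ℕ → ℝ := fun m => √Real.pi ^ m / Real.Gamma (m / 2 + 1) with hv
  have hpos : ∀ m, 0 ≤ v m := fun m => by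
    have : 0 < Real.Gamma ((m : ℝ) / 2 + 1) := Real.Gamma_pos_of_pos (by positivity)
    positivity
  have hstep : ∀ m, v (m + 2) = v m * (Real.pi / ((m : ℝ) / 2 + 1)) := fun m => by
    have h1 : ((m : ℝ) / 2 + 1) ≠ 0 := by positivity
    have : Real.Gamma ((m : ℝ) / 2 + 1) ≠ 0 := (Real.Gamma_pos_of_pos (by positivity)).ne'
    simp only [hv]
    rw [pow_add, Real.sq_sqrt Real.pi_nonneg, Nat.cast_add, Nat.cast_ofNat, add_div,
      div_self two_ne_zero, Real.Gamma_add_one h1]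
    field_simp
  have hle : ∀ m, v m ≤ ∑ i ∈ Finset.range 7, v i := by
    intro m
    induction m using Nat.strong_induction_on with
    | _ m ih =>
      rcases lt_or_ge m 7 with hm | hm
      · exact Finset.single_le_sum (fun i _ => hpos i) (Finset.mem_range.2 hm)
      · obtain ⟨j, rfl⟩ : ∃ j, m = j + 2 := ⟨m - 2, by omega⟩
        have hj : (5 : ℝ) ≤ j := by exact_mod_cast (by omega : 5 ≤ j)
        refine le_trans ?_ (ih j (by omega))
        rw [hstep]
        refine mul_le_of_le_one_right (hpos j) ?_
        rw [div_le_one (by positivity)]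
        linarith [Real.pi_lt_d2]
  refine ⟨max 1 (∑ i ∈ Finset.range 7, v i), le_max_left _ _, fun m hm => ?_⟩
  have : Nonempty (Fin m) := ⟨⟨0, Nat.pos_of_ne_zero hm⟩⟩
  rw [measureReal_def, EuclideanSpace.volume_ball]
  simp only [ENNReal.ofReal_one, one_pow, one_mul, Fintype.card_fin]
  rw [ENNReal.toReal_ofReal (hpos m)]
  exact (hle m).trans (le_max_right _ _)

lemma nontrivial_euclideanSpace_of_pos {m : ℕ} (hm : 0 < m) :
    Nontrivial (EuclideanSpace ℝ (Fin m)) :=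
  Module.nontrivial_of_finrank_pos (R := ℝ) (by simpa using hm)

/-- The Riesz kernel in terms of `ballVolume`. At the origin the left-hand side has the junk
value `0`. -/
lemma ofReal_one_div_norm_rpow_le {m : ℕ} {α : ℝ} (hαm : α < m) (x : EuclideanSpace ℝ (Fin m)) :
    ENNReal.ofReal ((1 / ‖x‖) ^ ((m : ℝ) - α)) ≤
      ENNReal.ofReal ((volume : Measure (EuclideanSpace ℝ (Fin m))).real (Metric.ball 0 1) ^
        (1 - α / m)) * ENNReal.ofReal (ballVolume volume x) ^ (α / m - 1) := by
  rcases eq_or_ne x 0 with rfl | hx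
  · rw [norm_zero, div_zero, Real.zero_rpow (by linarith), ENNReal.ofReal_zero]
    exact zero_le
  rcases eq_or_ne m 0 with rfl | hm
  · exact absurd (Subsingleton.elim x 0) hx
  have hV := unitBall_measureReal_pos (volume : Measure (EuclideanSpace ℝ (Fin m)))
  have hx' := norm_pos_iff.2 hx
  have hm' : (m : ℝ) ≠ 0 := by exact_mod_cast hm
  refine le_of_eq ?_
  rw [ENNReal.ofReal_rpow_of_pos (ballVolume_pos _ hx), ← ENNReal.ofReal_mul (by positivity),
    ballVolume, finrank_euclideanSpace_fin, Real.mul_rpow hV.le (by positivity), ← mul_assoc,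
    ← Real.rpow_add hV, ← Real.rpow_natCast, ← Real.rpow_mul hx'.le, one_div,
    Real.inv_rpow hx'.le, ← Real.rpow_neg hx'.le]
  congr 1
  rw [show 1 - α / m + (α / m - 1) = 0 by ring, Real.rpow_zero, one_mul]
  congr 1
  field_simp
  ring

lemma BilinearBound.mono {E : Type*} [Sub E] [MeasurableSpace E] {μ : Measure E}
    {k l : E → ℝ≥0∞} {p s : ℝ} {C D : ℝ≥0∞} (h : BilinearBound μ k p s C) (hlk : ∀ x, l x ≤ k x)
    (hCD : C ≤ D) : BilinearBound μ l p s D := by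
  intro f g hf hg
  calc _ ≤ ∫⁻ u, ∫⁻ x, f u * g x * k (x - u) ∂μ ∂μ := by
        gcongr with u x
        exact hlk _
    _ ≤ _ := h f g hf hg
    _ ≤ _ := by gcongr

/-- The Hardy–Littlewood–Sobolev inequality for Riesz kernels, with a constant depending only on
the exponents. -/
lemma exists_bilinearBound_riesz {p q s : ℝ} (hp : 1 < p) (hpq : p < q)
    (hqs : q.HolderConjugate s) :
    ∃ D : ℝ≥0, ∀ (m : ℕ) (α : ℝ), 0 < α → α < m → 1 / p - 1 / q = α / m →
      BilinearBound (volume : Measure (EuclideanSpace ℝ (Fin m)))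
        (fun x => ENNReal.ofReal ((1 / ‖x‖) ^ ((m : ℝ) - α))) p s D := by
  obtain ⟨W, hW1, hW⟩ := exists_unitBall_volume_le
  have hs : 1 / s = 1 - 1 / q := by
    have := hqs.inv_add_inv_eq_one
    simp only [one_div]
    linarith
  have hq0 : 0 < 1 / q := by
    have := hqs.pos
    positivity
  have hpq' : 1 / q < 1 / p := one_div_lt_one_div_of_lt (by linarith) hpq
  have hp1 : 1 / p < 1 := by rw [div_lt_one (by linarith)]; exact hp
  -- Any `ε` no larger than the gain in integrability and than the distances of `1 / p` and
  -- `1 / s` from `1` will do.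
  set ε := min (1 / p - 1 / q) (min (1 / q) (1 - 1 / p)) with hε
  have hε0 : 0 < ε := lt_min (by linarith) (lt_min hq0 (by linarith))
  have hε1 : ε ≤ 1 / p - 1 / q := min_le_left _ _
  have hε2 : ε ≤ 1 / q := (min_le_right _ _).trans (min_le_left _ _)
  have hε3 : ε ≤ 1 - 1 / p := (min_le_right _ _).trans (min_le_right _ _)
  set c : ℝ≥0∞ := 1 + ENNReal.ofReal (2 / ε) + ENNReal.ofReal (2 / ε) with hc
  have hct : ENNReal.ofReal W * c ≠ ∞ := by
    simp [hc, ENNReal.mul_eq_top]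
  refine ⟨(ENNReal.ofReal W * c).toNNReal, fun m α hα hαm h => ?_⟩
  rw [ENNReal.coe_toNNReal hct]
  have hm : 0 < m := by exact_mod_cast hα.trans hαm
  have := nontrivial_euclideanSpace_of_pos hm
  have key := bilinearBound_ballVolume (volume : Measure (EuclideanSpace ℝ (Fin m)))
    (p := p) (s := s) (ε := ε) (by linarith) hqs.symm.pos hε0 (by linarith) (by linarith)
    (by linarith)
  rw [show 1 / p + 1 / s - 2 = α / m - 1 by linarith] at key
  have hmeas := measurable_ballVolume (volume : Measure (EuclideanSpace ℝ (Fin m)))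
  refine (key.const_mul (by fun_prop) (ENNReal.ofReal
    ((volume : Measure (EuclideanSpace ℝ (Fin m))).real (Metric.ball 0 1) ^ (1 - α / m)))).mono
    (fun x => ofReal_one_div_norm_rpow_le hαm x) ?_
  gcongr
  have hθ : α / m ≤ 1 := by linarith
  have hθ' : 0 < α / m := by linarith
  calc _ ≤ W ^ (1 - α / m) := by
        apply Real.rpow_le_rpow measureReal_nonneg (hW m hm.ne')
        linarith
    _ ≤ W ^ (1 : ℝ) := Real.rpow_le_rpow_of_exponent_le hW1 (by linarith)
    _ = W := Real.rpow_one W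

lemma productKernel_nonneg {m n : ℕ} (α β : ℝ) (z : ProductSpace m n) :
    0 ≤ productKernel m n α β z := by
  unfold productKernel
  positivity

lemma measurable_productKernel {m n : ℕ} (α β : ℝ) : Measurable (productKernel m n α β) := by
  unfold productKernel
  fun_prop

/-- The estimate for the convolution of a nonnegative function with the product kernel. -/
lemma exists_lintegral_productKernel_le {p q : ℝ} (hp : 1 < p) (hpq : p < q) :
    ∃ A : ℝ≥0, ∀ (m n : ℕ) (α β : ℝ), 0 < α → α < m → 0 < β → β < n →
      ExponentRelation m n α β p q → ∀ f : ProductSpace m n → ℝ≥0∞, Measurable f →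
        (∫⁻ z, (∫⁻ w, f w * ‖productKernel m n α β (z - w)‖ₑ) ^ q) ^ (1 / q) ≤
          A * (∫⁻ w, f w ^ p) ^ (1 / p) := by
  have hqs : q.HolderConjugate (q.conjExponent) := Real.HolderConjugate.conjExponent (by linarith)
  obtain ⟨D, hD⟩ := exists_bilinearBound_riesz hp hpq hqs
  refine ⟨D * D, fun m n α β hα hαm hβ hβn h f hf => ?_⟩
  have key := (hD m α hα hαm h.1).prod (by linarith) hqs.symm.pos (by fun_prop) (by fun_prop)
    (hD n β hβ hβn (h.1.trans h.2))
  rw [← Measure.volume_eq_prod] at key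
  have henorm : ∀ z : ProductSpace m n, ‖productKernel m n α β z‖ₑ =
      ENNReal.ofReal ((1 / ‖z.1‖) ^ ((m : ℝ) - α)) *
        ENNReal.ofReal ((1 / ‖z.2‖) ^ ((n : ℝ) - β)) := fun z => by
    rw [Real.enorm_of_nonneg (productKernel_nonneg α β z), productKernel,
      ENNReal.ofReal_mul (by positivity)]
  simp only [henorm]
  rw [ENNReal.coe_mul]
  exact key.operator hqs (by fun_prop) hf

instance isAddHaarMeasure_productSpace (m n : ℕ) :
    (volume : Measure (ProductSpace m n)).IsAddHaarMeasure :=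
  inferInstanceAs
    ((volume : Measure (EuclideanSpace ℝ (Fin m))).prod
      (volume : Measure (EuclideanSpace ℝ (Fin n)))).IsAddHaarMeasure

section Convolution

variable {𝕜 : Type*} [RCLike 𝕜] {m n : ℕ}

lemma enorm_scalarMul (a : 𝕜) (r : ℝ) : ‖scalarMul 𝕜 a r‖ₑ = ‖a‖ₑ * ‖r‖ₑ := by
  simp [scalarMul, enorm_smul, mul_comm]

lemma aestronglyMeasurable_convKernel (α β : ℝ) {f : ProductSpace m n → 𝕜}
    (hf : AEStronglyMeasurable f volume) : AEStronglyMeasurable (convKernel α β f) volume :=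
  (AEStronglyMeasurable.convolution_integrand (scalarMul 𝕜) hf
    (measurable_productKernel α β).aestronglyMeasurable).integral_prod_right'

/-- The passage from nonnegative to scalar functions: the convolution is dominated by that of
`‖f‖`, whose finiteness almost everywhere is absolute convergence. -/
lemma convKernel_bounds {p q : ℝ} (hp : 1 < p) (hpq : p < q) {α β : ℝ} {A : ℝ≥0}
    (hA : ∀ g : ProductSpace m n → ℝ≥0∞, Measurable g →
        (∫⁻ z, (∫⁻ w, g w * ‖productKernel m n α β (z - w)‖ₑ) ^ q) ^ (1 / q) ≤
          A * (∫⁻ w, g w ^ p) ^ (1 / p))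
    {f : ProductSpace m n → 𝕜} (hf : MemLp f (ENNReal.ofReal p) volume) :
    eLpNorm (convKernel α β f) (ENNReal.ofReal q) volume
        ≤ A * eLpNorm f (ENNReal.ofReal p) volume ∧
      (∀ᵐ z ∂(volume : Measure (ProductSpace m n)), ConvKernelExistsAt α β f z) ∧
      MemLp (convKernel α β f) (ENNReal.ofReal q) volume := by
  have hp0 : 0 < p := by linarith
  have hq0 : 0 < q := by linarith
  have hfm : AEMeasurable (fun w => ‖f w‖ₑ) (volume : Measure (ProductSpace m n)) := hf.1.enorm
  set g := hfm.mk with hg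
  have hgf : ∀ᵐ w ∂(volume : Measure (ProductSpace m n)), ‖f w‖ₑ = g w := hfm.ae_eq_mk
  have hgm : Measurable g := hfm.measurable_mk
  have hk := measurable_productKernel (m := m) (n := n) α β
  have hfg : ∀ z, ∫⁻ w, ‖scalarMul 𝕜 (f w) (productKernel m n α β (z - w))‖ₑ =
      ∫⁻ w, g w * ‖productKernel m n α β (z - w)‖ₑ := fun z => by
    refine lintegral_congr_ae ?_
    filter_upwards [hgf] with w hw
    rw [enorm_scalarMul, hw]
  have hGm : Measurable fun z => ∫⁻ w, g w * ‖productKernel m n α β (z - w)‖ₑ := by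
    refine Measurable.lintegral_prod_right
      (f := fun z w => g w * ‖productKernel m n α β (z - w)‖ₑ) ?_
    simp only [Function.uncurry_def]
    fun_prop
  have hnorm : eLpNorm f (ENNReal.ofReal p) volume = (∫⁻ w, g w ^ p) ^ (1 / p) := by
    rw [eLpNorm_eq_lintegral_rpow_enorm_toReal (by simpa using hp0) ENNReal.ofReal_ne_top,
      ENNReal.toReal_ofReal hp0.le]
    congr 1
    refine lintegral_congr_ae ?_
    filter_upwards [hgf] with w hw
    rw [hw]
  have hbound : eLpNorm (convKernel α β f) (ENNReal.ofReal q) volume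
      ≤ A * eLpNorm f (ENNReal.ofReal p) volume := by
    rw [eLpNorm_eq_lintegral_rpow_enorm_toReal (by simpa using hq0) ENNReal.ofReal_ne_top,
      ENNReal.toReal_ofReal hq0.le, hnorm]
    refine le_trans ?_ (hA g hgm)
    gcongr with z
    exact (enorm_integral_le_lintegral_enorm _).trans (hfg z).le
  refine ⟨hbound, ?_, aestronglyMeasurable_convKernel α β hf.1,
    hbound.trans_lt (ENNReal.mul_lt_top ENNReal.coe_lt_top hf.2)⟩
  have hfin : (∫⁻ z, (∫⁻ w, g w * ‖productKernel m n α β (z - w)‖ₑ) ^ q) ≠ ∞ := by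
    have h := (hA g hgm).trans_lt
      (ENNReal.mul_lt_top ENNReal.coe_lt_top (hnorm ▸ hf.2 : _ < ∞))
    exact ((ENNReal.rpow_lt_top_iff_of_pos (by positivity)).1 h).ne
  filter_upwards [ae_lt_top (hGm.pow_const q) hfin] with z hz
  refine ⟨hf.1.convolution_integrand_snd (scalarMul 𝕜) hk.aestronglyMeasurable z, ?_⟩
  rw [hasFiniteIntegral_iff_enorm, hfg]
  exact (ENNReal.rpow_lt_top_iff_of_pos hq0).1 hz

end Convolution

/-! ### Necessity of the exponent relation -/

lemma eq_zero_of_forall_rpow_le {e M : ℝ} (h : ∀ t : ℝ, 0 < t → t ^ e ≤ M) : e = 0 := by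
  by_contra he
  -- At `t = (|M| + 1) ^ (1 / e)` the power equals `|M| + 1`.
  have := h ((|M| + 1) ^ e⁻¹) (by positivity)
  rw [Real.rpow_inv_rpow (by positivity) he] at this
  linarith [le_abs_self M]

/-- The Riesz kernel centred at any point is integrable on balls. -/
lemma integrableOn_one_div_norm_sub_rpow {m : ℕ} {α : ℝ} (hα : 0 < α) (hαm : α < m)
    (x : EuclideanSpace ℝ (Fin m)) (δ : ℝ) :
    IntegrableOn (fun u => (1 / ‖x - u‖) ^ ((m : ℝ) - α)) (Metric.ball 0 δ) := by
  have hd : 1 ≤ Module.finrank ℝ (EuclideanSpace ℝ (Fin m)) := by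
    have : (0 : ℝ) < m := hα.trans hαm
    rw [finrank_euclideanSpace_fin]
    exact_mod_cast this
  have h0 : LocallyIntegrable (fun u : EuclideanSpace ℝ (Fin m) => (1 / ‖u‖) ^ ((m : ℝ) - α)) := by
    refine locallyIntegrable_of_norm_le_rpow (C := 1) (α := m - α) hd
      (by rw [finrank_euclideanSpace_fin]; linarith) (.of_forall fun u => ?_)
      (Measurable.aestronglyMeasurable (by fun_prop))
    rw [Real.norm_of_nonneg (by positivity), one_div, Real.inv_rpow (norm_nonneg u), one_mul,
      Real.rpow_neg (norm_nonneg u)]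
  have h1 : IntegrableOn (fun u : EuclideanSpace ℝ (Fin m) => (1 / ‖u‖) ^ ((m : ℝ) - α))
      (Metric.closedBall x δ) := h0.integrableOn_isCompact (isCompact_closedBall x δ)
  have hmp := Measure.measurePreserving_sub_left
    (volume : Measure (EuclideanSpace ℝ (Fin m))) x
  have h2 := (hmp.integrableOn_comp_preimage
    (MeasurableEquiv.subLeft x).measurableEmbedding).2 h1
  refine IntegrableOn.mono_set h2 fun u hu => ?_
  simpa [dist_eq_norm] using (mem_ball_zero_iff.1 hu).le

section Necessity

variable {𝕜 : Type*} [RCLike 𝕜] {m n : ℕ}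

open Metric in
/-- Testing on the indicator of a product of balls: since two points of a ball of radius `δ` have
distance less than `2 δ`, the convolution is bounded below on the same product of balls. -/
lemma le_norm_convKernel_indicator {α β : ℝ} (hα : 0 < α) (hαm : α < m) (hβ : 0 < β) (hβn : β < n)
    {δ η : ℝ} (hδ : 0 < δ) (hη : 0 < η) {z : ProductSpace m n} (hz : z ∈ ball 0 δ ×ˢ ball 0 η) :
    (1 / (2 * δ)) ^ ((m : ℝ) - α) * (1 / (2 * η)) ^ ((n : ℝ) - β) *
        (volume : Measure (ProductSpace m n)).real (ball 0 δ ×ˢ ball 0 η) ≤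
      ‖convKernel α β ((ball 0 δ ×ˢ ball 0 η).indicator fun _ : ProductSpace m n => (1 : 𝕜)) z‖ := by
  set Q : Set (ProductSpace m n) := ball 0 δ ×ˢ ball 0 η with hQ
  have hQm : MeasurableSet Q := measurableSet_ball.prod measurableSet_ball
  have hQfin : volume Q ≠ ∞ := by
    rw [hQ, Measure.volume_eq_prod, Measure.prod_prod]
    exact ENNReal.mul_ne_top measure_ball_lt_top.ne measure_ball_lt_top.ne
  have hint : IntegrableOn (fun w => productKernel m n α β (z - w)) Q := by
    have := (integrableOn_one_div_norm_sub_rpow hα hαm z.1 δ).mul_prod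
      (integrableOn_one_div_norm_sub_rpow hβ hβn z.2 η)
    rwa [Measure.prod_restrict, ← Measure.volume_eq_prod] at this
  have hconv : convKernel α β (Q.indicator fun _ => (1 : 𝕜)) z =
      ((∫ w in Q, productKernel m n α β (z - w) : ℝ) : 𝕜) := by
    rw [← integral_ofReal, ← integral_indicator hQm, convKernel, convolution]
    congr 1
    ext w
    by_cases hw : w ∈ Q
    · simp [hw, scalarMul, RCLike.real_smul_eq_coe_mul]
    · simp [hw, scalarMul]
  rw [hconv, RCLike.norm_ofReal]
  refine le_trans ?_ (le_abs_self _)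
  rw [mul_comm, ← smul_eq_mul, ← setIntegral_const]
  have := nontrivial_euclideanSpace_of_pos (by exact_mod_cast hα.trans hαm : 0 < m)
  have := nontrivial_euclideanSpace_of_pos (by exact_mod_cast hβ.trans hβn : 0 < n)
  have hne₁ : ∀ᵐ w ∂(volume : Measure (ProductSpace m n)), w.1 ≠ z.1 :=
    Measure.quasiMeasurePreserving_fst.ae (Measure.ae_ne volume z.1)
  have hne₂ : ∀ᵐ w ∂(volume : Measure (ProductSpace m n)), w.2 ≠ z.2 :=
    Measure.quasiMeasurePreserving_snd.ae (Measure.ae_ne volume z.2)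
  have half : ∀ {k : ℕ} {γ r : ℝ} {x u : EuclideanSpace ℝ (Fin k)}, γ < k → 0 < r →
      x ∈ ball 0 r → u ∈ ball 0 r → u ≠ x →
      (1 / (2 * r)) ^ ((k : ℝ) - γ) ≤ (1 / ‖x - u‖) ^ ((k : ℝ) - γ) := by
    intro k γ r x u hγ hr hx hu hne
    have hpos : 0 < ‖x - u‖ := norm_pos_iff.2 (sub_ne_zero.2 hne.symm)
    rw [mem_ball_zero_iff] at hx hu
    have := norm_sub_le x u
    refine Real.rpow_le_rpow (by positivity) ?_ (by linarith)
    exact one_div_le_one_div_of_le hpos (by linarith)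
  refine setIntegral_mono_on_ae (integrableOn_const hQfin) hint hQm ?_
  filter_upwards [hne₁, hne₂] with w h₁ h₂ hw
  exact mul_le_mul (half hαm hδ hz.1 hw.1 h₁) (half hβn hη hz.2 hw.2 h₂) (by positivity)
    (Real.rpow_nonneg (by positivity) _)

/-- The inequality that a bound `‖f * Ω‖_q ≤ C ‖f‖_p` gives for indicators of products of balls. -/
lemma ProductHLSBound.rpow_mul_rpow_le {α β p q : ℝ} {C : ℝ≥0} (hp : 0 < p) (hq : 0 < q)
    (hα : 0 < α) (hαm : α < m) (hβ : 0 < β) (hβn : β < n) (h : ProductHLSBound 𝕜 m n α β p q C) :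
    ∃ M : ℝ, ∀ δ η : ℝ, 0 < δ → 0 < η →
      δ ^ (α + m * (1 / q - 1 / p)) * η ^ (β + n * (1 / q - 1 / p)) ≤ M := by
  set V := (volume : Measure (EuclideanSpace ℝ (Fin m))).real (Metric.ball 0 1) with hV
  set V' := (volume : Measure (EuclideanSpace ℝ (Fin n))).real (Metric.ball 0 1) with hV'
  have hV0 : 0 < V := unitBall_measureReal_pos _
  have hV0' : 0 < V' := unitBall_measureReal_pos _
  set r := 1 / q - 1 / p with hr
  set c : ℝ := (1 / 2) ^ ((m : ℝ) - α) * (1 / 2) ^ ((n : ℝ) - β) * (V * V') ^ (1 + r) with hc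
  have hc0 : 0 < c := by positivity
  refine ⟨C / c, fun δ η hδ hη => ?_⟩
  set Q : Set (ProductSpace m n) := Metric.ball 0 δ ×ˢ Metric.ball 0 η with hQ
  have hQm : MeasurableSet Q := measurableSet_ball.prod measurableSet_ball
  have hQvol : (volume : Measure (ProductSpace m n)) Q =
      ENNReal.ofReal (V * V' * (δ ^ m * η ^ n)) := by
    rw [hQ, Measure.volume_eq_prod, Measure.prod_prod, Measure.addHaar_ball_of_pos _ _ hδ,
      Measure.addHaar_ball_of_pos _ _ hη, finrank_euclideanSpace_fin, finrank_euclideanSpace_fin,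
      show V * V' * (δ ^ m * η ^ n) = δ ^ m * V * (η ^ n * V') by ring,
      ENNReal.ofReal_mul (by positivity), ENNReal.ofReal_mul (by positivity),
      ENNReal.ofReal_mul (by positivity), hV, hV', measureReal_def, measureReal_def,
      ENNReal.ofReal_toReal measure_ball_lt_top.ne, ENNReal.ofReal_toReal measure_ball_lt_top.ne]
  set v : ℝ := V * V' * (δ ^ m * η ^ n) with hv
  have hv0 : 0 < v := by positivity
  set κ : ℝ := (1 / (2 * δ)) ^ ((m : ℝ) - α) * (1 / (2 * η)) ^ ((n : ℝ) - β) * v with hκ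
  have hκ0 : 0 < κ := by positivity
  have hpe : ENNReal.ofReal p ≠ 0 := by simpa using hp
  have hqe : ENNReal.ofReal q ≠ 0 := by simpa using hq
  have hmain : ENNReal.ofReal κ * volume Q ^ (1 / q) ≤ C * volume Q ^ (1 / p) := by
    have h₁ : eLpNorm (Q.indicator fun _ => κ) (ENNReal.ofReal q) volume ≤
        eLpNorm (convKernel α β (Q.indicator fun _ => (1 : 𝕜))) (ENNReal.ofReal q) volume := by
      refine eLpNorm_mono fun z => ?_
      by_cases hz : z ∈ Q
      · rw [Set.indicator_of_mem hz, Real.norm_of_nonneg hκ0.le]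
        have := le_norm_convKernel_indicator (𝕜 := 𝕜) hα hαm hβ hβn hδ hη hz
        rwa [measureReal_def, ← hQ, hQvol, ENNReal.toReal_ofReal hv0.le] at this
      · simp [hz]
    have h₂ := h (Q.indicator fun _ => (1 : 𝕜))
      (memLp_indicator_const _ hQm _ (Or.inr (by rw [hQvol]; exact ENNReal.ofReal_ne_top)))
    have h₃ := h₁.trans h₂
    rwa [eLpNorm_indicator_const hQm hqe ENNReal.ofReal_ne_top,
      eLpNorm_indicator_const hQm hpe ENNReal.ofReal_ne_top, enorm_one, one_mul,
      ENNReal.toReal_ofReal hp.le, ENNReal.toReal_ofReal hq.le,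
      Real.enorm_of_nonneg hκ0.le] at h₃
  rw [hQvol, ENNReal.ofReal_rpow_of_pos hv0, ENNReal.ofReal_rpow_of_pos hv0,
    ← ENNReal.ofReal_mul hκ0.le, ← ENNReal.ofReal_coe_nnreal,
    ← ENNReal.ofReal_mul C.coe_nonneg, ENNReal.ofReal_le_ofReal_iff (by positivity)] at hmain
  have hdiv : κ * v ^ r ≤ C := by
    rw [hr, Real.rpow_sub hv0, ← mul_div_assoc, div_le_iff₀ (by positivity)]
    exact hmain
  rw [le_div_iff₀ hc0]
  refine le_of_eq_of_le ?_ hdiv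
  have e : ∀ {t γ : ℝ} {k : ℕ}, 0 < t → (1 / (2 * t)) ^ ((k : ℝ) - γ) * (t ^ k) ^ (1 + r) =
      (1 / 2) ^ ((k : ℝ) - γ) * t ^ (γ + k * r) := by
    intro t γ k ht
    rw [one_div, mul_inv, ← one_div, Real.mul_rpow (by positivity) (by positivity), mul_assoc,
      Real.inv_rpow ht.le, ← Real.rpow_neg ht.le, ← Real.rpow_natCast, ← Real.rpow_mul ht.le,
      ← Real.rpow_add ht]
    congr 2
    ring
  calc _ = ((1 / 2) ^ ((m : ℝ) - α) * δ ^ (α + m * r)) *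
          ((1 / 2) ^ ((n : ℝ) - β) * η ^ (β + n * r)) * (V * V') ^ (1 + r) := by
        rw [hc]
        ring
    _ = (1 / (2 * δ)) ^ ((m : ℝ) - α) * (1 / (2 * η)) ^ ((n : ℝ) - β) * v ^ (1 + r) := by
        rw [← e hδ, ← e hη, hv, Real.mul_rpow (x := V * V') (by positivity) (by positivity),
          Real.mul_rpow (x := δ ^ m) (by positivity) (by positivity)]
        ring
    _ = κ * v ^ r := by
        rw [hκ, Real.rpow_add hv0, Real.rpow_one]
        ring

lemma ProductHLSBound.exponentRelation {α β p q : ℝ} {C : ℝ≥0} (hp : 0 < p) (hq : 0 < q)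
    (hα : 0 < α) (hαm : α < m) (hβ : 0 < β) (hβn : β < n) (h : ProductHLSBound 𝕜 m n α β p q C) :
    ExponentRelation m n α β p q := by
  obtain ⟨M, hM⟩ := h.rpow_mul_rpow_le hp hq hα hαm hβ hβn
  have h₁ := eq_zero_of_forall_rpow_le fun t ht => by simpa using hM t 1 ht one_pos
  have h₂ := eq_zero_of_forall_rpow_le fun t ht => by simpa using hM 1 t one_pos ht
  have hm : (m : ℝ) ≠ 0 := (hα.trans hαm).ne'
  have hn : (n : ℝ) ≠ 0 := (hβ.trans hβn).ne'
  have e₁ : α / m = 1 / p - 1 / q := by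
    rw [div_eq_iff hm]
    simp only [one_div]
    linarith
  have e₂ : β / n = 1 / p - 1 / q := by
    rw [div_eq_iff hn]
    simp only [one_div]
    linarith
  exact ⟨e₁.symm, e₁.trans e₂.symm⟩

end Necessity

theorem mainTheorem1 {𝕜 : Type*} [RCLike 𝕜] (p q : ℝ) (hp : 1 < p) (hpq : p < q) :
    ∃ A : ℝ≥0, ∀ (m n : ℕ) (α β : ℝ), 0 < α → α < (m : ℝ) → 0 < β → β < (n : ℝ) →
      ((∃ C : ℝ≥0, ProductHLSBound 𝕜 m n α β p q C) ↔ ExponentRelation m n α β p q) ∧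
      (ExponentRelation m n α β p q →
        ProductHLSBound 𝕜 m n α β p q A ∧
        ∀ f : ProductSpace m n → 𝕜, MemLp f (ENNReal.ofReal p) volume →
          (∀ᵐ z ∂(volume : Measure (ProductSpace m n)), ConvKernelExistsAt α β f z) ∧
          MemLp (convKernel α β f) (ENNReal.ofReal q) volume) := by
  obtain ⟨A, hA⟩ := exists_lintegral_productKernel_le hp hpq
  refine ⟨A, fun m n α β hα hαm hβ hβn => ?_⟩
  have suff := fun h f (hf : MemLp f (ENNReal.ofReal p) volume) =>
    convKernel_bounds (𝕜 := 𝕜) hp hpq (hA m n α β hα hαm hβ hβn h) hf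
  exact ⟨⟨fun ⟨_, hC⟩ => hC.exponentRelation (by linarith) (by linarith) hα hαm hβ hβn,
    fun h => ⟨A, fun f hf => (suff h f hf).1⟩⟩,
    fun h => ⟨fun f hf => (suff h f hf).1, fun f hf => (suff h f hf).2⟩⟩
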